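/- For complex $a,b,c$ let $F(a,b;c;\cdot)$ denote the Gauss hypergeometric function, i.e. the analytic continuation to $\mathbb{C}\setminus[1,\infty)$ of $\sum_{k\ge0}\frac{(a)_k(b)_k}{(c)_k\,k!}z^k$ $(|z|<1)$, and consider the six solutions of the hypergeometric differential equation on real intervals \begin{align*} w_1(x;a,b,c)&=F(a,b;c;x) && (x<1),\\ w_2(x;a,b,c)&=|x|^{1-c}F(a-c+1,b-c+1;2-c;x) && (x\in(-\infty,0)\cup(0,1)),\\ w_3(x;a,b,c)&=|x|^{-a}F(a,a-c+1;a-b+1;x^{-1}) && (x\in(-\infty,0)\cup(1,\infty)),\\ w_4(x;a,b,c)&=|x|^{-b}F(b,b-c+1;b-a+1;x^{-1}) && (x\in(-\infty,0)\cup(1,\infty)),\\ w_5(x;a,b,c)&=F(a,b;a+b-c+1;1-x) && (x>0),\\ w_6(x;a,b,c)&=|1-x|^{c-a-b}F(c-a,c-b;c-a-b+1;1-x) && (x\in(0,1)\cup(1,\infty)). \end{align*} Put $$E_1(x,y)=|x|^{1-c}|y|^{b-1}|1-y|^{-a}|x-y|^{c-b-1},\qquad E_2(x,y)=|y|^{a-c}|1-y|^{c-b-1}|x-y|^{-a}.$$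 Then the following twelve formulas hold, for real $x$ and complex $a,b,c$ as indicated, and every integral in them converges absolutely. Integrand $E_1$: \begin{align*} w_1&=\tfrac{\Gamma(c)}{\Gamma(b)\Gamma(c-b)}\int_{0<y/x<1}E_1\,dy && (x\in(-\infty,0)\cup(0,1),\ \Re c>\Re b>0),\\ w_2&=\tfrac{\Gamma(2-c)}{\Gamma(a-c+1)\Gamma(1-a)}\int_1^\infty E_1\,dy && (x\in(-\infty,0)\cup(0,1),\ \Re(c-1)<\Re a<1),\\ w_3&=\tfrac{\Gamma(a-b+1)}{\Gamma(a-c+1)\Gamma(c-b)}\int_{y/x>1}E_1\,dy && (x\in(-\infty,0)\cup(1,\infty),\ \Re(a-c+1)>0,\ \Re(c-b)>0),\\ w_4&=\tfrac{\Gamma(b-a+1)}{\Gamma(1-a)\Gamma(b)}\int_0^1E_1\,dy && (x\in(-\infty,0)\cup(1,\infty),\ \Re a<1,\ \Re b>0),\\ w_5&=\tfrac{\Gamma(a+b-c+1)}{\Gamma(a-c+1)\Gamma(b)}\int_{-\infty}^0E_1\,dy && (x>0,\ \Re b>0,\ \Re(a-c+1)>0),\\ w_6&=\tfrac{\Gamma(c-a-b+1)}{\Gamma(1-a)\Gamma(c-b)}\int_{0<\frac{1-y}{1-x}<1}E_1\,dy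 && (x\in(0,1)\cup(1,\infty),\ \Re(c-b)>0,\ \Re a<1). \end{align*} Integrand $E_2$: \begin{align*} w_1&=\tfrac{\Gamma(c)}{\Gamma(b)\Gamma(c-b)}\int_1^\infty E_2\,dy && (x<1,\ \Re c>\Re b>0),\\ w_2&=\tfrac{\Gamma(2-c)}{\Gamma(a-c+1)\Gamma(1-a)}\int_{0<y/x<1}E_2\,dy && (x\in(-\infty,0)\cup(0,1),\ 2>\Re(a+1)>\Re c),\\ w_3&=\tfrac{\Gamma(a-b+1)}{\Gamma(a-c+1)\Gamma(c-b)}\int_0^1E_2\,dy && (x\in(-\infty,0)\cup(1,\infty),\ \Re(a+1)>\Re c>\Re b),\\ w_4&=\tfrac{\Gamma(b-a+1)}{\Gamma(1-a)\Gamma(b)}\int_{y/x>1}E_2\,dy && (x\in(-\infty,0)\cup(1,\infty),\ \Re a<1,\ \Re b>0),\\ w_5&=\tfrac{\Gamma(a+b-c+1)}{\Gamma(a-c+1)\Gamma(b)}\int_{-\infty}^0E_2\,dy && (x>0,\ \Re b>0,\ \Re(a+1)>\Re c),\\ w_6&=\tfrac{\Gamma(c-a-b+1)}{\Gamma(1-a)\Gamma(c-b)}\int_{0<\frac{1-y}{1-x}<1}E_2\,dy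 && (x\in(0,1)\cup(1,\infty),\ \Re(c-b)>0,\ \Re a<1). \end{align*} -/

import Mathlib

open MeasureTheory

noncomputable section

/-- The complex plane cut along `[1, ∞)`. -/
def cutPlane : Set ℂ := {z : ℂ | 1 - z ∈ Complex.slitPlane}

/-- `F` is an analytic continuation to the cut plane `ℂ \ [1, ∞)` of the Gauss hypergeometric
series `∑ (a)ₖ (b)ₖ / ((c)ₖ k!) zᵏ`, `|z| < 1`. -/
def IsGaussContinuation (a b c : ℂ) (F : ℂ → ℂ) : Prop :=
  AnalyticOnNhd ℂ F cutPlane ∧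
    ∀ z ∈ Metric.ball (0 : ℂ) 1, F z = ordinaryHypergeometric a b c z

/-- The cut plane is the complement of the half-line `[1, ∞)`. -/
theorem mem_cutPlane_iff (z : ℂ) : z ∈ cutPlane ↔ ¬ ∃ t : ℝ, 1 ≤ t ∧ z = (t : ℂ) := by
  unfold cutPlane
  rw [Set.mem_ofPred_eq, Complex.mem_slitPlane_iff]
  constructor
  · rintro h ⟨t, ht, rfl⟩
    simp at h
    linarith
  · intro h
    by_contra! hc
    obtain ⟨h1, h2⟩ := hc
    simp at h1 h2
    exact h ⟨z.re, h1, Complex.ext (by simp) (by simpa using h2)⟩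

/-- Two analytic continuations agree on the cut plane, so the continuation chosen in
`gaussF` below is the only one there. -/
theorem IsGaussContinuation.eqOn {a b c : ℂ} {F G : ℂ → ℂ}
    (hF : IsGaussContinuation a b c F) (hG : IsGaussContinuation a b c G) :
    Set.EqOn F G cutPlane := by
  have h0 : (0 : ℂ) ∈ cutPlane := by
    simp [cutPlane, Complex.mem_slitPlane_iff]
  have hstar : StarConvex ℝ (0 : ℂ) cutPlane := by
    intro z hz s t hs ht hst
    simp only [cutPlane, Set.mem_ofPred_eq, Complex.mem_slitPlane_iff, smul_zero, zero_add,
      Complex.sub_re, Complex.one_re, Complex.sub_im, Complex.one_im, Complex.real_smul,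
      Complex.mul_re, Complex.mul_im, Complex.ofReal_re, Complex.ofReal_im, zero_mul,
      sub_zero, add_zero, zero_sub] at hz ⊢
    rcases ht.eq_or_lt with rfl | ht
    · left; simp
    · rcases hz with hz | hz
      · left; nlinarith
      · right
        simpa [ht.ne'] using hz
  refine hF.1.eqOn_of_preconnected_of_eventuallyEq hG.1
    (hstar.isPathConnected h0).isConnected.isPreconnected h0 ?_
  filter_upwards [Metric.ball_mem_nhds (0 : ℂ) one_pos] with z hz
  rw [hF.2 z hz, hG.2 z hz]

open Classical in
/-- The Gauss hypergeometric function `F(a, b; c; z)` on `ℂ \ [1, ∞)`: the analytic continuation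
of the hypergeometric series. A continuation always exists (classically), so the second branch,
which only makes the definition total, does not occur. -/
def gaussF (a b c : ℂ) : ℂ → ℂ :=
  if h : ∃ F : ℂ → ℂ, IsGaussContinuation a b c F then h.choose
  else fun z => ordinaryHypergeometric a b c z

/-- The complex power `|t|^s` of the absolute value of a real number. -/
def absPow (t : ℝ) (s : ℂ) : ℂ := ((|t| : ℝ) : ℂ) ^ s

/-- `w₁(x; a, b, c)`, for `x ∈ (-∞, 1)`. -/
def w₁ (x : ℝ) (a b c : ℂ) : ℂ := gaussF a b c (x : ℂ)

/-- `w₂(x; a, b, c)`, for `x ∈ (-∞, 0) ∪ (0, 1)`. -/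
def w₂ (x : ℝ) (a b c : ℂ) : ℂ :=
  absPow x (1 - c) * gaussF (a - c + 1) (b - c + 1) (2 - c) (x : ℂ)

/-- `w₃(x; a, b, c)`, for `x ∈ (-∞, 0) ∪ (1, ∞)`. -/
def w₃ (x : ℝ) (a b c : ℂ) : ℂ :=
  absPow x (-a) * gaussF a (a - c + 1) (a - b + 1) ((x : ℂ)⁻¹)

/-- `w₄(x; a, b, c)`, for `x ∈ (-∞, 0) ∪ (1, ∞)`. -/
def w₄ (x : ℝ) (a b c : ℂ) : ℂ :=
  absPow x (-b) * gaussF b (b - c + 1) (b - a + 1) ((x : ℂ)⁻¹)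

/-- `w₅(x; a, b, c)`, for `x ∈ (0, ∞)`. -/
def w₅ (x : ℝ) (a b c : ℂ) : ℂ := gaussF a b (a + b - c + 1) (1 - (x : ℂ))

/-- `w₆(x; a, b, c)`, for `x ∈ (0, 1) ∪ (1, ∞)`. -/
def w₆ (x : ℝ) (a b c : ℂ) : ℂ :=
  absPow (1 - x) (c - a - b) * gaussF (c - a) (c - b) (c - a - b + 1) (1 - (x : ℂ))

/-- The integrand `|x|^(1-c) |y|^(b-1) |1-y|^(-a) |x-y|^(c-b-1)` of the first kind. -/
def eulerI (a b c : ℂ) (x y : ℝ) : ℂ :=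
  absPow x (1 - c) * absPow y (b - 1) * absPow (1 - y) (-a) * absPow (x - y) (c - b - 1)

/-- The integrand `|y|^(a-c) |1-y|^(c-b-1) |x-y|^(-a)` of the second kind. -/
def eulerII (a b c : ℂ) (x y : ℝ) : ℂ :=
  absPow y (a - c) * absPow (1 - y) (c - b - 1) * absPow (x - y) (-a)

/-- The integral of `f` over `I` converges absolutely, and `w` is `C` times this integral. -/
def HasEulerRep (w C : ℂ) (f : ℝ → ℂ) (I : Set ℝ) : Prop :=
  IntegrableOn f I ∧ w = C * ∫ y in I, f y

end

noncomputable section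

/-- The weight `t^(b-1) (1-t)^(c-b-1)` of Euler's integral. -/
def eulerWeight (b c : ℂ) (t : ℝ) : ℂ := (t : ℂ) ^ (b - 1) * (1 - (t : ℂ)) ^ (c - b - 1)

theorem integrableOn_eulerWeight {b c : ℂ} (hb : 0 < b.re) (hc : b.re < c.re) :
    IntegrableOn (eulerWeight b c) (Set.Ioo 0 1) := by
  have h := Complex.betaIntegral_convergent (u := b) (v := c - b) hb (by simpa using hc)
  rw [intervalIntegrable_iff_integrableOn_Ioo_of_le zero_le_one] at h
  exact h

theorem integral_eulerWeight_mul_pow {b c : ℂ} (hb : 0 < b.re) (hc : b.re < c.re) (n : ℕ) :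
    Complex.Gamma c / (Complex.Gamma b * Complex.Gamma (c - b)) *
      ∫ t in Set.Ioo (0 : ℝ) 1, eulerWeight b c t * (t : ℂ) ^ n =
    (ascPochhammer ℂ n).eval b * ((ascPochhammer ℂ n).eval c)⁻¹ := by
  have hb' : ∀ k : ℕ, b ≠ -k := by
    rintro k rfl
    simp at hb
    linarith [(Nat.cast_nonneg k : (0 : ℝ) ≤ k)]
  have hc' : ∀ k : ℕ, c ≠ -k := by
    rintro k rfl
    simp at hc
    linarith [(Nat.cast_nonneg k : (0 : ℝ) ≤ k)]
  have h1 : ∫ t in Set.Ioo (0 : ℝ) 1, eulerWeight b c t * (t : ℂ) ^ n =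
      Complex.betaIntegral (b + n) (c - b) := by
    rw [Complex.betaIntegral, intervalIntegral.integral_of_le zero_le_one,
      integral_Ioc_eq_integral_Ioo]
    refine setIntegral_congr_fun measurableSet_Ioo fun t ht => ?_
    have : (t : ℂ) ≠ 0 := by exact_mod_cast ht.1.ne'
    simp only [eulerWeight]
    rw [show b + n - 1 = b - 1 + n by ring, Complex.cpow_add _ _ this, Complex.cpow_natCast]
    ring
  have hre : 0 < (b + n).re := by
    simp only [Complex.add_re, Complex.natCast_re]; positivity
  have h2 := Complex.Gamma_mul_Gamma_eq_betaIntegral hre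
    (show 0 < (c - b).re by simpa using hc)
  rw [show b + n + (c - b) = c + n by ring] at h2
  have gb := Complex.Gamma_ne_zero hb'
  have gc := Complex.Gamma_ne_zero hc'
  have gcb : Complex.Gamma (c - b) ≠ 0 :=
    Complex.Gamma_ne_zero_of_re_pos (by simpa using hc)
  have gcn : Complex.Gamma (c + n) ≠ 0 :=
    Complex.Gamma_ne_zero_of_re_pos (by
      simp only [Complex.add_re, Complex.natCast_re]
      have : (0 : ℝ) ≤ n := n.cast_nonneg
      linarith)
  rw [h1, ← Complex.Gamma_add_nat_div_Gamma_eq b hb', ← Complex.Gamma_add_nat_div_Gamma_eq c hc']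
  field_simp
  linear_combination -h2

theorem hasSum_one_sub_cpow_neg (a : ℂ) {w : ℂ} (hw : ‖w‖ < 1) :
    HasSum (fun n : ℕ => ((n.factorial : ℂ)⁻¹ * (ascPochhammer ℂ n).eval a) * w ^ n)
      ((1 - w) ^ (-a)) := by
  have h := (Complex.one_add_cpow_hasFPowerSeriesOnBall_zero (a := -a)).hasSum
    (y := -w) (by simpa [enorm_eq_nnnorm, ← NNReal.coe_lt_coe] using hw)
  have h1 : ∀ k : ℕ, (k : ℂ) ≠ -1 := fun k hk => by
    have := congrArg Complex.re hk
    simp at this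
    linarith [(Nat.cast_nonneg k : (0 : ℝ) ≤ k)]
  rw [binomialSeries_eq_ordinaryHypergeometricSeries (b := (1 : ℂ)) h1] at h
  have key : ∀ n : ℕ, (ordinaryHypergeometricSeries ℂ (- -a) 1 1).compContinuousLinearMap
      (-(ContinuousLinearMap.id ℂ ℂ)) n (fun _ => -w) =
      ((n.factorial : ℂ)⁻¹ * (ascPochhammer ℂ n).eval a) * w ^ n := by
    intro n
    rw [FormalMultilinearSeries.compContinuousLinearMap_apply]
    have : ⇑(-(ContinuousLinearMap.id ℂ ℂ)) ∘ (fun _ : Fin n => -w) = fun _ => w := by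
      ext; simp
    rw [this, ordinaryHypergeometricSeries_apply_eq, neg_neg,
      mul_inv_cancel_right₀ (by simp [Nat.factorial_ne_zero]), smul_eq_mul]
  simpa only [key, zero_add, ← sub_eq_add_neg, zero_sub] using h

/-- Euler's integral `∫₀¹ t^(b-1) (1-t)^(c-b-1) (1-zt)^(-a) dt`. -/
def eulerIntegral (a b c z : ℂ) : ℂ :=
  ∫ t in Set.Ioo (0 : ℝ) 1, eulerWeight b c t * (1 - z * t) ^ (-a)

theorem integral_eulerWeight_series {a b c z : ℂ} (hb : 0 < b.re) (hc : b.re < c.re)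
    (hz : ‖z‖ < 1) :
    Complex.Gamma c / (Complex.Gamma b * Complex.Gamma (c - b)) * eulerIntegral a b c z =
      ordinaryHypergeometric a b c z := by
  have hφ := integrableOn_eulerWeight hb hc
  set p : ℕ → ℂ := fun n => (n.factorial : ℂ)⁻¹ * (ascPochhammer ℂ n).eval a with hp
  set F : ℕ → ℝ → ℂ := fun n t => eulerWeight b c t * (p n * (z * t) ^ n) with hF
  have hbound : ∀ n, ∀ t ∈ Set.Ioo (0 : ℝ) 1,
      ‖F n t‖ ≤ ‖p n * z ^ n‖ * ‖eulerWeight b c t‖ := by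
    intro n t ht
    simp only [hF, norm_mul, norm_pow, mul_pow, Complex.norm_real, Real.norm_eq_abs,
      abs_of_pos ht.1]
    have : t ^ n ≤ 1 := pow_le_one₀ ht.1.le ht.2.le
    calc _ = (‖p n‖ * ‖z‖ ^ n * ‖eulerWeight b c t‖) * t ^ n := by ring
      _ ≤ _ := mul_le_of_le_one_right (by positivity) this
  have hFi : ∀ n, IntegrableOn (F n) (Set.Ioo 0 1) := by
    intro n
    refine Integrable.mono' (hφ.norm.const_mul ‖p n * z ^ n‖) ?_ ?_
    · exact hφ.aestronglyMeasurable.mul (by fun_prop : Continuous _).aestronglyMeasurable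
    · exact (ae_restrict_iff' measurableSet_Ioo).2 (.of_forall (hbound n))
  have hsum : Summable fun n => ∫ t in Set.Ioo (0 : ℝ) 1, ‖F n t‖ := by
    refine Summable.of_nonneg_of_le (fun n => integral_nonneg fun _ => norm_nonneg _) (fun n => ?_)
      ((hasSum_one_sub_cpow_neg a hz).summable.norm.mul_right
        (∫ t in Set.Ioo (0 : ℝ) 1, ‖eulerWeight b c t‖))
    rw [← integral_const_mul]
    exact setIntegral_mono_on (hFi n).norm (hφ.norm.const_mul _) measurableSet_Ioo (hbound n)
  have h := hasSum_integral_of_summable_integral_norm hFi hsum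
  have h1 : ∫ t in Set.Ioo (0 : ℝ) 1, ∑' n, F n t = eulerIntegral a b c z := by
    refine setIntegral_congr_fun measurableSet_Ioo fun t ht => ?_
    have hzt : ‖z * t‖ < 1 := by
      rw [norm_mul, Complex.norm_real, Real.norm_eq_abs, abs_of_pos ht.1]
      nlinarith [norm_nonneg z, ht.1, ht.2]
    exact ((hasSum_one_sub_cpow_neg a hzt).mul_left _).tsum_eq
  rw [h1] at h
  rw [ordinaryHypergeometric_eq_tsum, ← h.tsum_eq, ← tsum_mul_left]
  refine tsum_congr fun n => ?_
  have h2 : ∫ t in Set.Ioo (0 : ℝ) 1, F n t =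
      (p n * z ^ n) * ∫ t in Set.Ioo (0 : ℝ) 1, eulerWeight b c t * (t : ℂ) ^ n := by
    rw [← integral_const_mul]
    refine integral_congr_ae (.of_forall fun t => ?_)
    simp only [hF, mul_pow]
    ring
  rw [h2, mul_left_comm, integral_eulerWeight_mul_pow hb hc, smul_eq_mul, hp]
  ring

theorem isOpen_cutPlane : IsOpen cutPlane :=
  Complex.isOpen_slitPlane.preimage (by fun_prop : Continuous fun z : ℂ => 1 - z)

theorem one_sub_mul_mem_slitPlane {z : ℂ} (hz : z ∈ cutPlane) {t : ℝ} (ht : t ∈ Set.Icc (0 : ℝ) 1) :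
    1 - z * t ∈ Complex.slitPlane := by
  have hz : 1 - z ∈ Complex.slitPlane := hz
  rw [Complex.mem_slitPlane_iff] at hz ⊢
  simp only [Complex.sub_re, Complex.one_re, Complex.mul_re, Complex.ofReal_re, Complex.ofReal_im,
    mul_zero, sub_zero, Complex.sub_im, Complex.one_im, zero_sub, Complex.mul_im, ne_eq,
    neg_eq_zero, zero_add] at hz ⊢
  rcases ht.1.eq_or_lt with h | h
  · left; simp [← h]
  · rcases hz with hz | hz
    · left; nlinarith [ht.2]
    · right; simpa [h.ne'] using hz

theorem continuousOn_one_sub_mul_cpow (s : ℂ) :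
    ContinuousOn (fun q : ℂ × ℝ => (1 - q.1 * q.2) ^ s) (cutPlane ×ˢ Set.Icc (0 : ℝ) 1) := by
  refine ContinuousOn.cpow_const (by fun_prop) fun q hq => ?_
  exact one_sub_mul_mem_slitPlane hq.1 hq.2

theorem continuousOn_one_sub_mul_cpow_right (s : ℂ) {z : ℂ} (hz : z ∈ cutPlane) :
    ContinuousOn (fun t : ℝ => (1 - z * t) ^ s) (Set.Icc (0 : ℝ) 1) :=
  ContinuousOn.cpow_const (by fun_prop) fun _ ht => one_sub_mul_mem_slitPlane hz ht

theorem integrableOn_euler {b c : ℂ} (hb : 0 < b.re) (hc : b.re < c.re) (s : ℂ) {z : ℂ}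
    (hz : z ∈ cutPlane) :
    IntegrableOn (fun t : ℝ => eulerWeight b c t * (1 - z * t) ^ s) (Set.Ioo 0 1) := by
  have h := (integrableOn_Icc_iff_integrableOn_Ioo (μ := volume)).2 (integrableOn_eulerWeight hb hc)
  exact (h.mul_continuousOn (continuousOn_one_sub_mul_cpow_right s hz) isCompact_Icc).mono_set
    Set.Ioo_subset_Icc_self

theorem analyticOnNhd_eulerIntegral (a : ℂ) {b c : ℂ} (hb : 0 < b.re) (hc : b.re < c.re) :
    AnalyticOnNhd ℂ (eulerIntegral a b c) cutPlane := by
  refine DifferentiableOn.analyticOnNhd (fun z₀ hz₀ => ?_) isOpen_cutPlane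
  obtain ⟨ε, hε, hball⟩ := Metric.nhds_basis_closedBall.mem_iff.1 (isOpen_cutPlane.mem_nhds hz₀)
  obtain ⟨M, hM⟩ := ((isCompact_closedBall z₀ ε).prod
    (isCompact_Icc (a := (0 : ℝ)) (b := 1))).exists_bound_of_continuousOn
    ((continuousOn_one_sub_mul_cpow (-a - 1)).mono (Set.prod_mono hball subset_rfl))
  have hφ := integrableOn_eulerWeight hb hc
  refine (hasDerivAt_integral_of_dominated_loc_of_deriv_le (𝕜 := ℂ)
    (F := fun z (t : ℝ) => eulerWeight b c t * (1 - z * t) ^ (-a))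
    (F' := fun z (t : ℝ) => eulerWeight b c t * (-a * (1 - z * t) ^ (-a - 1) * (-t)))
    (bound := fun t => ‖eulerWeight b c t‖ * (‖a‖ * M))
    (Metric.closedBall_mem_nhds z₀ hε) ?_ (integrableOn_euler hb hc _ hz₀) ?_ ?_
    (hφ.norm.mul_const _) ?_).2.differentiableAt.differentiableWithinAt
  · filter_upwards [isOpen_cutPlane.mem_nhds hz₀] with z hz
    exact (integrableOn_euler hb hc _ hz).aestronglyMeasurable
  · refine hφ.aestronglyMeasurable.mul (ContinuousOn.aestronglyMeasurable ?_ measurableSet_Ioo)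
    exact (continuousOn_const.mul ((continuousOn_one_sub_mul_cpow_right _ hz₀).mono
      Set.Ioo_subset_Icc_self)).mul (by fun_prop)
  · refine (ae_restrict_iff' measurableSet_Ioo).2 (.of_forall fun t ht z hz => ?_)
    have h1 := hM (z, t) ⟨hz, Set.Ioo_subset_Icc_self ht⟩
    simp only at h1
    simp only [norm_mul, norm_neg, Complex.norm_real, Real.norm_eq_abs, abs_of_pos ht.1]
    have hM0 : 0 ≤ M := (norm_nonneg _).trans h1
    refine mul_le_mul_of_nonneg_left ?_ (norm_nonneg _)
    calc _ ≤ ‖a‖ * M * 1 :=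
          mul_le_mul (mul_le_mul_of_nonneg_left h1 (norm_nonneg a)) ht.2.le ht.1.le (by positivity)
      _ = _ := mul_one _
  · refine (ae_restrict_iff' measurableSet_Ioo).2 (.of_forall fun t ht z hz => ?_)
    have h1 : HasDerivAt (fun z : ℂ => 1 - z * t) (-t) z := by
      simpa using ((hasDerivAt_id z).mul_const (t : ℂ)).const_sub 1
    exact (h1.cpow_const
      (one_sub_mul_mem_slitPlane (hball hz) (Set.Ioo_subset_Icc_self ht))).const_mul _

/-- **Euler's integral representation** of the Gauss hypergeometric function. -/
theorem gaussF_eq_eulerIntegral (a : ℂ) {b c : ℂ} (hb : 0 < b.re) (hc : b.re < c.re) {z : ℂ}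
    (hz : z ∈ cutPlane) :
    gaussF a b c z =
      Complex.Gamma c / (Complex.Gamma b * Complex.Gamma (c - b)) * eulerIntegral a b c z := by
  have h : IsGaussContinuation a b c fun z =>
      Complex.Gamma c / (Complex.Gamma b * Complex.Gamma (c - b)) * eulerIntegral a b c z :=
    ⟨analyticOnNhd_const.mul (analyticOnNhd_eulerIntegral a hb hc), fun z hz =>
      integral_eulerWeight_series hb hc (by simpa using hz)⟩
  have hex : ∃ F, IsGaussContinuation a b c F := ⟨_, h⟩
  rw [gaussF, dif_pos hex]
  exact hex.choose_spec.eqOn h hz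

theorem gaussF_symm (a b c : ℂ) : gaussF a b c = gaussF b a c := by
  have h : (ordinaryHypergeometric a b c : ℂ → ℂ) = ordinaryHypergeometric b a c := by
    ext z
    rw [ordinaryHypergeometric, ordinaryHypergeometricSeries_symm, ordinaryHypergeometric]
  have h' : IsGaussContinuation a b c = IsGaussContinuation b a c := by
    ext F
    rw [IsGaussContinuation, h, IsGaussContinuation]
  have hcongr : ∀ (P Q : (ℂ → ℂ) → Prop) (s r : ℂ → ℂ), P = Q → s = r →
      (open Classical in if h : ∃ F, P F then h.choose else s) =
        (open Classical in if h : ∃ F, Q F then h.choose else r) := by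
    rintro P _ s _ rfl rfl
    rfl
  exact hcongr _ _ _ _ h' h

theorem absPow_eq_exp {p : ℝ} (hp : p ≠ 0) (s : ℂ) :
    absPow p s = Complex.exp (Real.log |p| * s) := by
  have h : ((|p| : ℝ) : ℂ) ≠ 0 := by simpa using hp
  rw [absPow, Complex.cpow_def_of_ne_zero h, Complex.ofReal_log (abs_nonneg p)]

theorem absPow_mul (p q : ℝ) (s : ℂ) : absPow (p * q) s = absPow p s * absPow q s := by
  rw [absPow, abs_mul, Complex.ofReal_mul,
    Complex.mul_cpow_ofReal_nonneg (abs_nonneg p) (abs_nonneg q), absPow, absPow]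

theorem absPow_inv (p : ℝ) (s : ℂ) : absPow p⁻¹ s = absPow p (-s) := by
  rw [absPow, abs_inv, Complex.ofReal_inv, Complex.inv_cpow, ← Complex.cpow_neg, absPow]
  rw [Complex.arg_ofReal_of_nonneg (abs_nonneg p)]
  exact Real.pi_ne_zero.symm

theorem absPow_div (p q : ℝ) (s : ℂ) : absPow (p / q) s = absPow p s * absPow q (-s) := by
  rw [div_eq_mul_inv, absPow_mul, absPow_inv]

theorem absPow_neg (p : ℝ) (s : ℂ) : absPow (-p) s = absPow p s := by
  rw [absPow, abs_neg, absPow]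

theorem absPow_one (s : ℂ) : absPow 1 s = 1 := by
  simp [absPow]

theorem ofReal_mem_cutPlane {x : ℝ} (hx : x < 1) : (x : ℂ) ∈ cutPlane := by
  rw [mem_cutPlane_iff]
  rintro ⟨t, ht, h⟩
  rw [Complex.ofReal_inj] at h
  linarith

/-- A function which a change of variables carries to the integrand of Euler's integral has an
integral representation. -/
theorem hasEulerRep_of_substitution {A B C D K w G : ℂ} {Z : ℝ} {f : ℝ → ℂ} {I : Set ℝ}
    (g h g' : ℝ → ℝ) (hZ : Z < 1) (hB : 0 < B.re) (hD : 0 < D.re) (hC : C = B + D)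
    (hw : w = K * gaussF A B C Z)
    (hG : G = Complex.Gamma C / (Complex.Gamma B * Complex.Gamma D))
    (hg : ∀ t, 0 < t → t < 1 → g t ∈ I ∧ h (g t) = t)
    (hh : ∀ y ∈ I, (0 < h y ∧ h y < 1) ∧ g (h y) = y)
    (hd : ∀ t, 0 < t → t < 1 → HasDerivAt g (g' t) t)
    (hf : ∀ t, 0 < t → t < 1 → absPow (g' t) 1 * f (g t) =
      K * (absPow t (B - 1) * absPow (1 - t) (D - 1) * absPow (1 - Z * t) (-A))) :
    HasEulerRep w G f I := by
  obtain rfl : D = C - B := by rw [hC]; ring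
  have hBC : B.re < C.re := by simpa using hD
  have hI : g '' Set.Ioo 0 1 = I := by
    ext y
    constructor
    · rintro ⟨t, ht, rfl⟩
      exact (hg t ht.1 ht.2).1
    · exact fun hy => ⟨h y, (hh y hy).1, (hh y hy).2⟩
  have hinj : Set.InjOn g (Set.Ioo 0 1) :=
    Set.LeftInvOn.injOn (f₁' := h) fun t ht => (hg t ht.1 ht.2).2
  have hd' : ∀ t ∈ Set.Ioo (0 : ℝ) 1, HasDerivWithinAt g (g' t) (Set.Ioo 0 1) t :=
    fun t ht => (hd t ht.1 ht.2).hasDerivWithinAt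
  have heq : Set.EqOn (fun t => |g' t| • f (g t))
      (fun t => K * (eulerWeight B C t * (1 - Z * t) ^ (-A))) (Set.Ioo 0 1) := by
    intro t ht
    have h1 := hf t ht.1 ht.2
    have hZt : 0 < 1 - Z * t := by nlinarith [ht.1, ht.2]
    simp only [absPow, Complex.cpow_one, abs_of_pos ht.1, abs_of_pos (sub_pos.2 ht.2),
      abs_of_pos hZt] at h1
    simp only [Complex.real_smul, h1, eulerWeight]
    push_cast
    ring
  have hint := (integrableOn_euler hB hBC (-A) (ofReal_mem_cutPlane hZ)).const_mul K
  constructor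
  · rw [← hI, integrableOn_image_iff_integrableOn_abs_deriv_smul measurableSet_Ioo hd' hinj]
    exact IntegrableOn.congr_fun hint heq.symm measurableSet_Ioo
  · rw [hw, hG, gaussF_eq_eulerIntegral A hB hBC (ofReal_mem_cutPlane hZ), ← hI,
      integral_image_eq_integral_abs_deriv_smul measurableSet_Ioo hd' hinj,
      setIntegral_congr_fun measurableSet_Ioo heq, integral_const_mul, eulerIntegral]
    ring

theorem pos_one_sub_mul {x t : ℝ} (hx : x < 1) (h0 : 0 < t) (h1 : t < 1) : 0 < 1 - x * t := by
  nlinarith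

theorem inv_lt_one_of_neg_or_one_lt {x : ℝ} (hx : x < 0 ∨ 1 < x) : x⁻¹ < 1 := by
  rcases hx with hx | hx
  · exact (inv_neg''.2 hx).trans one_pos
  · exact inv_lt_one_of_one_lt₀ hx

section Substitution

variable {A B C D K w G : ℂ} {f : ℝ → ℂ}

theorem hasEulerRep_of_substitution_mul {x Z : ℝ} (hx : x ≠ 0) (hZ : Z < 1) (hB : 0 < B.re)
    (hD : 0 < D.re) (hC : C = B + D) (hw : w = K * gaussF A B C Z)
    (hG : G = Complex.Gamma C / (Complex.Gamma B * Complex.Gamma D))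
    (hf : ∀ t, 0 < t → t < 1 → absPow x 1 * f (x * t) =
      K * (absPow t (B - 1) * absPow (1 - t) (D - 1) * absPow (1 - Z * t) (-A))) :
    HasEulerRep w G f {y : ℝ | 0 < y / x ∧ y / x < 1} := by
  refine hasEulerRep_of_substitution (fun t => x * t) (fun y => y / x) (fun _ => x)
    hZ hB hD hC hw hG (fun t h0 h1 => ?_) (fun y hy => ⟨hy, ?_⟩) (fun t h0 h1 => ?_) hf
  · simp [hx, h0, h1]
  · field_simp
  · simpa using (hasDerivAt_id t).const_mul x

theorem hasEulerRep_of_substitution_id {Z : ℝ} (hZ : Z < 1) (hB : 0 < B.re)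
    (hD : 0 < D.re) (hC : C = B + D) (hw : w = K * gaussF A B C Z)
    (hG : G = Complex.Gamma C / (Complex.Gamma B * Complex.Gamma D))
    (hf : ∀ t, 0 < t → t < 1 → absPow 1 1 * f t =
      K * (absPow t (B - 1) * absPow (1 - t) (D - 1) * absPow (1 - Z * t) (-A))) :
    HasEulerRep w G f (Set.Ioo 0 1) :=
  hasEulerRep_of_substitution (fun t => t) (fun y => y) (fun _ => 1)
    hZ hB hD hC hw hG (fun _ h0 h1 => ⟨⟨h0, h1⟩, rfl⟩) (fun _ hy => ⟨hy, rfl⟩)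
    (fun t _ _ => hasDerivAt_id t) hf

theorem hasEulerRep_of_substitution_div {x Z : ℝ} (hx : x ≠ 0) (hZ : Z < 1) (hB : 0 < B.re)
    (hD : 0 < D.re) (hC : C = B + D) (hw : w = K * gaussF A B C Z)
    (hG : G = Complex.Gamma C / (Complex.Gamma B * Complex.Gamma D))
    (hf : ∀ t, 0 < t → t < 1 → absPow (-(x / (t * t))) 1 * f (x / t) =
      K * (absPow t (B - 1) * absPow (1 - t) (D - 1) * absPow (1 - Z * t) (-A))) :
    HasEulerRep w G f {y : ℝ | 1 < y / x} := by
  refine hasEulerRep_of_substitution (fun t => x / t) (fun y => x / y) (fun t => -(x / (t * t)))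
    hZ hB hD hC hw hG (fun t h0 h1 => ⟨?_, ?_⟩) (fun y hy => ⟨?_, ?_⟩) (fun t h0 h1 => ?_) hf
  · have : x / t / x = t⁻¹ := by field_simp
    simpa only [Set.mem_ofPred_eq, this] using (one_lt_inv₀ h0).2 h1
  · field_simp
  · have hy : 1 < y / x := hy
    rw [← inv_div y x]
    exact ⟨by positivity, inv_lt_one_of_one_lt₀ hy⟩
  · have : y ≠ 0 := by
      rintro rfl
      simp at hy
      linarith
    field_simp
  · convert! (hasDerivAt_inv h0.ne').const_mul x using 1
    field_simp

theorem hasEulerRep_of_substitution_inv {Z : ℝ} (hZ : Z < 1) (hB : 0 < B.re)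
    (hD : 0 < D.re) (hC : C = B + D) (hw : w = K * gaussF A B C Z)
    (hG : G = Complex.Gamma C / (Complex.Gamma B * Complex.Gamma D))
    (hf : ∀ t, 0 < t → t < 1 → absPow (-(1 / (t * t))) 1 * f (1 / t) =
      K * (absPow t (B - 1) * absPow (1 - t) (D - 1) * absPow (1 - Z * t) (-A))) :
    HasEulerRep w G f (Set.Ioi 1) := by
  simpa only [div_one] using!
    hasEulerRep_of_substitution_div one_ne_zero hZ hB hD hC hw hG hf

theorem hasEulerRep_of_substitution_neg_mul_div {x Z : ℝ} (hx : 0 < x) (hZ : Z < 1) (hB : 0 < B.re)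
    (hD : 0 < D.re) (hC : C = B + D) (hw : w = K * gaussF A B C Z)
    (hG : G = Complex.Gamma C / (Complex.Gamma B * Complex.Gamma D))
    (hf : ∀ t, 0 < t → t < 1 →
      absPow (-(x / ((1 - t) * (1 - t)))) 1 * f (-(x * t / (1 - t))) =
      K * (absPow t (B - 1) * absPow (1 - t) (D - 1) * absPow (1 - Z * t) (-A))) :
    HasEulerRep w G f (Set.Iio 0) := by
  refine hasEulerRep_of_substitution (fun t => -(x * t / (1 - t))) (fun y => -y / (x - y))
    (fun t => -(x / ((1 - t) * (1 - t))))
    hZ hB hD hC hw hG (fun t h0 h1 => ⟨?_, ?_⟩) (fun y hy => ⟨⟨?_, ?_⟩, ?_⟩)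
    (fun t h0 h1 => ?_) hf
  · have : 0 < 1 - t := sub_pos.2 h1
    exact Set.mem_Iio.2 (neg_lt_zero.2 (by positivity))
  · have : 1 - t ≠ 0 := (sub_pos.2 h1).ne'
    have h2 : x - -(x * t / (1 - t)) = x / (1 - t) := by field_simp; ring
    rw [h2]
    field_simp
  · have hy : y < 0 := hy
    exact div_pos (by linarith) (by linarith)
  · have hy : y < 0 := hy
    rw [div_lt_one (by linarith)]
    linarith
  · have hy : y < 0 := hy
    have h1 : x - y ≠ 0 := by linarith
    have h2 : 1 - -y / (x - y) = x / (x - y) := by field_simp; ring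
    simp only [h2]
    field_simp
  · have h2 : 1 - t ≠ 0 := (sub_pos.2 h1).ne'
    convert! (((hasDerivAt_id t).const_mul x).div ((hasDerivAt_id t).const_sub 1) h2).neg using 1
    simp only [id]
    field_simp
    ring

theorem hasEulerRep_of_substitution_neg_div {Z : ℝ} (hZ : Z < 1) (hB : 0 < B.re)
    (hD : 0 < D.re) (hC : C = B + D) (hw : w = K * gaussF A B C Z)
    (hG : G = Complex.Gamma C / (Complex.Gamma B * Complex.Gamma D))
    (hf : ∀ t, 0 < t → t < 1 →
      absPow ((t * t)⁻¹) 1 * f (-((1 - t) / t)) =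
      K * (absPow t (B - 1) * absPow (1 - t) (D - 1) * absPow (1 - Z * t) (-A))) :
    HasEulerRep w G f (Set.Iio 0) := by
  refine hasEulerRep_of_substitution (fun t => -((1 - t) / t)) (fun y => (1 - y)⁻¹)
    (fun t => (t * t)⁻¹)
    hZ hB hD hC hw hG (fun t h0 h1 => ⟨?_, ?_⟩) (fun y hy => ⟨⟨?_, ?_⟩, ?_⟩)
    (fun t h0 h1 => ?_) hf
  · have : 0 < 1 - t := sub_pos.2 h1
    exact Set.mem_Iio.2 (neg_lt_zero.2 (by positivity))
  · have h2 : 1 - -((1 - t) / t) = t⁻¹ := by field_simp; ring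
    rw [h2, inv_inv]
  · have hy : y < 0 := hy
    exact inv_pos.2 (by linarith)
  · have hy : y < 0 := hy
    exact inv_lt_one_of_one_lt₀ (by linarith)
  · have hy : y < 0 := hy
    have h1 : 1 - y ≠ 0 := by linarith
    field_simp
    ring
  · convert! (((hasDerivAt_id t).const_sub 1).div (hasDerivAt_id t) h0.ne').neg using 1
    simp only [id]
    field_simp
    ring

theorem hasEulerRep_of_substitution_one_sub {x Z : ℝ} (hx : x ≠ 1) (hZ : Z < 1) (hB : 0 < B.re)
    (hD : 0 < D.re) (hC : C = B + D) (hw : w = K * gaussF A B C Z)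
    (hG : G = Complex.Gamma C / (Complex.Gamma B * Complex.Gamma D))
    (hf : ∀ t, 0 < t → t < 1 → absPow (-(1 - x)) 1 * f (1 - (1 - x) * t) =
      K * (absPow t (B - 1) * absPow (1 - t) (D - 1) * absPow (1 - Z * t) (-A))) :
    HasEulerRep w G f {y : ℝ | 0 < (1 - y) / (1 - x) ∧ (1 - y) / (1 - x) < 1} := by
  have hx' : 1 - x ≠ 0 := sub_ne_zero.2 hx.symm
  refine hasEulerRep_of_substitution (fun t => 1 - (1 - x) * t) (fun y => (1 - y) / (1 - x))
    (fun _ => -(1 - x))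
    hZ hB hD hC hw hG (fun t h0 h1 => ?_) (fun y hy => ⟨hy, ?_⟩) (fun t h0 h1 => ?_) hf
  · simp [hx', h0, h1]
  · field_simp
    ring
  · simpa using ((hasDerivAt_id t).const_mul (1 - x)).const_sub 1

theorem hasEulerRep_of_substitution_div_one_sub {x Z : ℝ} (hx0 : 0 < x) (hx : x ≠ 1) (hZ : Z < 1)
    (hB : 0 < B.re) (hD : 0 < D.re) (hC : C = B + D) (hw : w = K * gaussF A B C Z)
    (hG : G = Complex.Gamma C / (Complex.Gamma B * Complex.Gamma D))
    (hf : ∀ t, 0 < t → t < 1 →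
      absPow (x * (1 - x) / ((1 - (1 - x) * t) * (1 - (1 - x) * t))) 1 *
        f (x / (1 - (1 - x) * t)) =
      K * (absPow t (B - 1) * absPow (1 - t) (D - 1) * absPow (1 - Z * t) (-A))) :
    HasEulerRep w G f {y : ℝ | 0 < (1 - y) / (1 - x) ∧ (1 - y) / (1 - x) < 1} := by
  have hx' : 1 - x ≠ 0 := sub_ne_zero.2 hx.symm
  have key : ∀ t, 0 < t → t < 1 → 0 < 1 - (1 - x) * t := fun t h0 h1 =>
    pos_one_sub_mul (by linarith) h0 h1
  have inner : ∀ t, 0 < t → t < 1 →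
      (1 - x / (1 - (1 - x) * t)) / (1 - x) = (1 - t) / (1 - (1 - x) * t) := fun t h0 h1 => by
    have := (key t h0 h1).ne'
    field_simp
    ring
  have hlt : ∀ t, 0 < t → t < 1 →
      0 < (1 - t) / (1 - (1 - x) * t) ∧ (1 - t) / (1 - (1 - x) * t) < 1 := fun t h0 h1 =>
    ⟨div_pos (by linarith) (key t h0 h1), (div_lt_one (key t h0 h1)).2 (by nlinarith)⟩
  have hinv : ∀ t, 0 < t → t < 1 → (1 - (1 - t) / (1 - (1 - x) * t)) /
      (1 - (1 - x) * ((1 - t) / (1 - (1 - x) * t))) = t := fun t h0 h1 => by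
    have h2 := (key t h0 h1).ne'
    have h3 : 1 - (1 - x) * ((1 - t) / (1 - (1 - x) * t)) = x / (1 - (1 - x) * t) := by
      field_simp
      ring
    have h4 : 1 - (1 - t) / (1 - (1 - x) * t) = x * t / (1 - (1 - x) * t) := by
      rw [one_sub_div h2]
      ring
    rw [h3, h4, div_div_div_cancel_right₀ h2, mul_div_cancel_left₀ _ hx0.ne']
  refine hasEulerRep_of_substitution (fun t => x / (1 - (1 - x) * t))
    (fun y => (1 - (1 - y) / (1 - x)) / (1 - (1 - x) * ((1 - y) / (1 - x))))
    (fun t => x * (1 - x) / ((1 - (1 - x) * t) * (1 - (1 - x) * t)))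
    hZ hB hD hC hw hG (fun t h0 h1 => ⟨?_, ?_⟩) (fun y hy => ⟨hlt _ hy.1 hy.2, ?_⟩)
    (fun t h0 h1 => ?_) hf
  · simpa only [Set.mem_ofPred_eq, inner t h0 h1] using hlt t h0 h1
  · simp only [inner t h0 h1]
    exact hinv t h0 h1
  · have h1 : 1 - (1 - x) * ((1 - y) / (1 - x)) = y := by field_simp; ring
    have h2 := key _ hy.1 hy.2
    rw [h1] at h2
    have h3 : 1 - (1 - x) * ((1 - (1 - y) / (1 - x)) / y) = x / y := by
      field_simp
      ring
    simp only [h1, h3]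
    field_simp
  · have h2 : HasDerivAt (fun t => 1 - (1 - x) * t) (-(1 - x)) t := by
      simpa using ((hasDerivAt_id t).const_mul (1 - x)).const_sub 1
    convert! (h2.inv (key t h0 h1).ne').const_mul x using 1
    field_simp [(key t h0 h1).ne']

end Substitution

end

theorem mainTheorem6 (a b c : ℂ) (x : ℝ) :
    -- integrand `|x|^(1-c) |y|^(b-1) |1-y|^(-a) |x-y|^(c-b-1)`
    ((x < 0 ∨ (0 < x ∧ x < 1)) → b.re < c.re → 0 < b.re →
      HasEulerRep (w₁ x a b c) (Complex.Gamma c / (Complex.Gamma b * Complex.Gamma (c - b)))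
        (eulerI a b c x) {y : ℝ | 0 < y / x ∧ y / x < 1}) ∧
    ((x < 0 ∨ (0 < x ∧ x < 1)) → (c - 1).re < a.re → a.re < 1 →
      HasEulerRep (w₂ x a b c)
        (Complex.Gamma (2 - c) / (Complex.Gamma (a - c + 1) * Complex.Gamma (1 - a)))
        (eulerI a b c x) (Set.Ioi 1)) ∧
    ((x < 0 ∨ 1 < x) → 0 < (a - c + 1).re → 0 < (c - b).re →
      HasEulerRep (w₃ x a b c)
        (Complex.Gamma (a - b + 1) / (Complex.Gamma (a - c + 1) * Complex.Gamma (c - b)))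
        (eulerI a b c x) {y : ℝ | 1 < y / x}) ∧
    ((x < 0 ∨ 1 < x) → a.re < 1 → 0 < b.re →
      HasEulerRep (w₄ x a b c)
        (Complex.Gamma (b - a + 1) / (Complex.Gamma (1 - a) * Complex.Gamma b))
        (eulerI a b c x) (Set.Ioo 0 1)) ∧
    (0 < x → 0 < b.re → 0 < (a - c + 1).re →
      HasEulerRep (w₅ x a b c)
        (Complex.Gamma (a + b - c + 1) / (Complex.Gamma (a - c + 1) * Complex.Gamma b))
        (eulerI a b c x) (Set.Iio 0)) ∧
    (((0 < x ∧ x < 1) ∨ 1 < x) → 0 < (c - b).re → a.re < 1 →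
      HasEulerRep (w₆ x a b c)
        (Complex.Gamma (c - a - b + 1) / (Complex.Gamma (1 - a) * Complex.Gamma (c - b)))
        (eulerI a b c x) {y : ℝ | 0 < (1 - y) / (1 - x) ∧ (1 - y) / (1 - x) < 1}) ∧
    -- integrand `|y|^(a-c) |1-y|^(c-b-1) |x-y|^(-a)`
    (x < 1 → b.re < c.re → 0 < b.re →
      HasEulerRep (w₁ x a b c) (Complex.Gamma c / (Complex.Gamma b * Complex.Gamma (c - b)))
        (eulerII a b c x) (Set.Ioi 1)) ∧
    ((x < 0 ∨ (0 < x ∧ x < 1)) → (a + 1).re < 2 → c.re < (a + 1).re →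
      HasEulerRep (w₂ x a b c)
        (Complex.Gamma (2 - c) / (Complex.Gamma (a - c + 1) * Complex.Gamma (1 - a)))
        (eulerII a b c x) {y : ℝ | 0 < y / x ∧ y / x < 1}) ∧
    ((x < 0 ∨ 1 < x) → c.re < (a + 1).re → b.re < c.re →
      HasEulerRep (w₃ x a b c)
        (Complex.Gamma (a - b + 1) / (Complex.Gamma (a - c + 1) * Complex.Gamma (c - b)))
        (eulerII a b c x) (Set.Ioo 0 1)) ∧
    ((x < 0 ∨ 1 < x) → a.re < 1 → 0 < b.re →
      HasEulerRep (w₄ x a b c)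
        (Complex.Gamma (b - a + 1) / (Complex.Gamma (1 - a) * Complex.Gamma b))
        (eulerII a b c x) {y : ℝ | 1 < y / x}) ∧
    (0 < x → 0 < b.re → c.re < (a + 1).re →
      HasEulerRep (w₅ x a b c)
        (Complex.Gamma (a + b - c + 1) / (Complex.Gamma (a - c + 1) * Complex.Gamma b))
        (eulerII a b c x) (Set.Iio 0)) ∧
    (((0 < x ∧ x < 1) ∨ 1 < x) → 0 < (c - b).re → a.re < 1 →
      HasEulerRep (w₆ x a b c)
        (Complex.Gamma (c - a - b + 1) / (Complex.Gamma (1 - a) * Complex.Gamma (c - b)))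
        (eulerII a b c x) {y : ℝ | 0 < (1 - y) / (1 - x) ∧ (1 - y) / (1 - x) < 1}) := by

  have pos : ∀ t : ℝ, t < 1 → 0 < 1 - t := fun t => sub_pos.2
  refine ⟨fun hx h1 h2 => ?_, fun hx h1 h2 => ?_, fun hx h1 h2 => ?_, fun hx h1 h2 => ?_,
    fun hx h1 h2 => ?_, fun hx h1 h2 => ?_, fun hx h1 h2 => ?_, fun hx h1 h2 => ?_,
    fun hx h1 h2 => ?_, fun hx h1 h2 => ?_, fun hx h1 h2 => ?_, fun hx h1 h2 => ?_⟩
  · have hx0 : x ≠ 0 := by grind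
    have hx1 : x < 1 := by grind
    refine hasEulerRep_of_substitution_mul (A := a) (B := b) (C := c) (D := c - b) (K := 1)
      hx0 hx1 h2 (by simpa using h1) (by ring) (by rw [w₁, one_mul]) rfl fun t t0 t1 => ?_
    have e : x - x * t = x * (1 - t) := by ring
    simp only [eulerI, e, absPow_mul, absPow_eq_exp hx0, absPow_eq_exp t0.ne',
      absPow_eq_exp (pos t t1).ne', absPow_eq_exp (pos_one_sub_mul hx1 t0 t1).ne',
      ← Complex.exp_add, one_mul]
    congr 1
    ring
  · have hx0 : x ≠ 0 := by grind
    have hx1 : x < 1 := by grind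
    refine hasEulerRep_of_substitution_inv (A := b - c + 1) (B := a - c + 1) (C := 2 - c)
      (D := 1 - a) (K := absPow x (1 - c)) hx1 (by simp at h1 ⊢; linarith) (by simpa using h2)
      (by ring) (by rw [w₂, gaussF_symm]) rfl fun t t0 t1 => ?_
    have e1 : 1 - 1 / t = -((1 - t) / t) := by field_simp; ring
    have e2 : x - 1 / t = -((1 - x * t) / t) := by field_simp; ring
    simp only [eulerI, e1, e2, absPow_neg, absPow_mul, absPow_div, absPow_one, absPow_eq_exp hx0,
      absPow_eq_exp t0.ne',
      absPow_eq_exp (pos t t1).ne', absPow_eq_exp (pos_one_sub_mul hx1 t0 t1).ne',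
      ← Complex.exp_add, one_mul]
    congr 1
    ring
  · have hx0 : x ≠ 0 := by grind
    have hx1 := inv_lt_one_of_neg_or_one_lt hx
    refine hasEulerRep_of_substitution_div (A := a) (B := a - c + 1) (C := a - b + 1)
      (D := c - b) (K := absPow x (-a)) hx0 hx1 h1 h2
      (by ring) (by rw [w₃, Complex.ofReal_inv]) rfl fun t t0 t1 => ?_
    have e1 : 1 - x / t = -(x * (1 - x⁻¹ * t) / t) := by field_simp; ring
    have e2 : x - x / t = -(x * (1 - t) / t) := by field_simp; ring
    simp only [eulerI, e1, e2, absPow_neg, absPow_mul, absPow_div, absPow_eq_exp hx0,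
      absPow_eq_exp t0.ne',
      absPow_eq_exp (pos t t1).ne', absPow_eq_exp (pos_one_sub_mul hx1 t0 t1).ne',
      ← Complex.exp_add]
    congr 1
    ring
  · have hx0 : x ≠ 0 := by grind
    have hx1 := inv_lt_one_of_neg_or_one_lt hx
    refine hasEulerRep_of_substitution_id (A := b - c + 1) (B := b) (C := b - a + 1)
      (D := 1 - a) (K := absPow x (-b)) hx1 h2 (by simpa using h1)
      (by ring) (by rw [w₄, Complex.ofReal_inv, gaussF_symm]) (by rw [mul_comm (Complex.Gamma b)])
      fun t t0 t1 => ?_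
    have e : x - t = x * (1 - x⁻¹ * t) := by field_simp
    simp only [eulerI, e, absPow_mul, absPow_one, absPow_eq_exp hx0, absPow_eq_exp t0.ne',
      absPow_eq_exp (pos t t1).ne', absPow_eq_exp (pos_one_sub_mul hx1 t0 t1).ne',
      ← Complex.exp_add, one_mul]
    congr 1
    ring
  · have hx1 : 1 - x < 1 := by linarith
    refine hasEulerRep_of_substitution_neg_mul_div (A := a) (B := b) (C := a + b - c + 1)
      (D := a - c + 1) (K := 1) hx hx1 h1 h2
      (by ring) (by rw [w₅, one_mul, Complex.ofReal_sub, Complex.ofReal_one])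
      (by rw [mul_comm (Complex.Gamma b)]) fun t t0 t1 => ?_
    have ht := (pos t t1).ne'
    have e1 : 1 - -(x * t / (1 - t)) = (1 - (1 - x) * t) / (1 - t) := by field_simp; ring
    have e2 : x - -(x * t / (1 - t)) = x / (1 - t) := by field_simp; ring
    simp only [eulerI, e1, e2, absPow_neg, absPow_mul, absPow_div, absPow_eq_exp hx.ne',
      absPow_eq_exp t0.ne',
      absPow_eq_exp ht, absPow_eq_exp (pos_one_sub_mul hx1 t0 t1).ne',
      ← Complex.exp_add, one_mul]
    congr 1
    ring
  · have hx0 : 0 < x := by grind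
    have hx1 : 1 - x < 1 := by linarith
    have hx2 : x ≠ 1 := by grind
    have hx3 : 1 - x ≠ 0 := sub_ne_zero.2 hx2.symm
    refine hasEulerRep_of_substitution_div_one_sub (A := c - a) (B := c - b) (C := c - a - b + 1)
      (D := 1 - a) (K := absPow (1 - x) (c - a - b)) hx0 hx2 hx1 h1 (by simpa using h2)
      (by ring) (by rw [w₆, Complex.ofReal_sub, Complex.ofReal_one])
      (by rw [mul_comm (Complex.Gamma (c - b))]) fun t t0 t1 => ?_
    have hD := (pos_one_sub_mul hx1 t0 t1).ne'
    have e1 : 1 - x / (1 - (1 - x) * t) = (1 - x) * (1 - t) / (1 - (1 - x) * t) := by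
      field_simp; ring
    have e2 : x - x / (1 - (1 - x) * t) = -(x * (1 - x) * t / (1 - (1 - x) * t)) := by
      field_simp; ring
    simp only [eulerI, e1, e2, absPow_neg, absPow_mul, absPow_div, absPow_eq_exp hx0.ne',
      absPow_eq_exp hx3, absPow_eq_exp t0.ne', absPow_eq_exp (pos t t1).ne', absPow_eq_exp hD,
      ← Complex.exp_add]
    congr 1
    ring
  · refine hasEulerRep_of_substitution_inv (A := a) (B := b) (C := c) (D := c - b) (K := 1)
      hx h2 (by simpa using h1) (by ring) (by rw [w₁, one_mul]) rfl fun t t0 t1 => ?_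
    have e1 : 1 - 1 / t = -((1 - t) / t) := by field_simp; ring
    have e2 : x - 1 / t = -((1 - x * t) / t) := by field_simp; ring
    simp only [eulerII, e1, e2, absPow_neg, absPow_mul, absPow_div, absPow_one,
      absPow_eq_exp t0.ne',
      absPow_eq_exp (pos t t1).ne', absPow_eq_exp (pos_one_sub_mul hx t0 t1).ne',
      ← Complex.exp_add, one_mul]
    congr 1
    ring
  · have hx0 : x ≠ 0 := by grind
    have hx1 : x < 1 := by grind
    refine hasEulerRep_of_substitution_mul (A := b - c + 1) (B := a - c + 1) (C := 2 - c)
      (D := 1 - a) (K := absPow x (1 - c)) hx0 hx1 (by simp at h2 ⊢; linarith)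
      (by simp at h1 ⊢; linarith)
      (by ring) (by rw [w₂, gaussF_symm]) rfl fun t t0 t1 => ?_
    have e : x - x * t = x * (1 - t) := by ring
    simp only [eulerII, e, absPow_mul, absPow_eq_exp hx0, absPow_eq_exp t0.ne',
      absPow_eq_exp (pos t t1).ne', absPow_eq_exp (pos_one_sub_mul hx1 t0 t1).ne',
      ← Complex.exp_add]
    congr 1
    ring
  · have hx0 : x ≠ 0 := by grind
    have hx1 := inv_lt_one_of_neg_or_one_lt hx
    refine hasEulerRep_of_substitution_id (A := a) (B := a - c + 1) (C := a - b + 1)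
      (D := c - b) (K := absPow x (-a)) hx1 (by simp at h1 ⊢; linarith) (by simpa using h2)
      (by ring) (by rw [w₃, Complex.ofReal_inv]) rfl fun t t0 t1 => ?_
    have e : x - t = x * (1 - x⁻¹ * t) := by field_simp
    simp only [eulerII, e, absPow_mul, absPow_one, absPow_eq_exp hx0, absPow_eq_exp t0.ne',
      absPow_eq_exp (pos t t1).ne', absPow_eq_exp (pos_one_sub_mul hx1 t0 t1).ne',
      ← Complex.exp_add, one_mul]
    congr 1
    ring
  · have hx0 : x ≠ 0 := by grind
    have hx1 := inv_lt_one_of_neg_or_one_lt hx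
    refine hasEulerRep_of_substitution_div (A := b - c + 1) (B := b) (C := b - a + 1)
      (D := 1 - a) (K := absPow x (-b)) hx0 hx1 h2 (by simpa using h1)
      (by ring) (by rw [w₄, Complex.ofReal_inv, gaussF_symm]) (by rw [mul_comm (Complex.Gamma b)])
      fun t t0 t1 => ?_
    have e1 : 1 - x / t = -(x * (1 - x⁻¹ * t) / t) := by field_simp; ring
    have e2 : x - x / t = -(x * (1 - t) / t) := by field_simp; ring
    simp only [eulerII, e1, e2, absPow_neg, absPow_mul, absPow_div, absPow_eq_exp hx0,
      absPow_eq_exp t0.ne',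
      absPow_eq_exp (pos t t1).ne', absPow_eq_exp (pos_one_sub_mul hx1 t0 t1).ne',
      ← Complex.exp_add]
    congr 1
    ring
  · have hx1 : 1 - x < 1 := by linarith
    refine hasEulerRep_of_substitution_neg_div (A := a) (B := b) (C := a + b - c + 1)
      (D := a - c + 1) (K := 1) hx1 h1 (by simp at h2 ⊢; linarith)
      (by ring) (by rw [w₅, one_mul, Complex.ofReal_sub, Complex.ofReal_one])
      (by rw [mul_comm (Complex.Gamma b)]) fun t t0 t1 => ?_
    have e1 : 1 - -((1 - t) / t) = t⁻¹ := by field_simp; ring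
    have e2 : x - -((1 - t) / t) = (1 - (1 - x) * t) / t := by field_simp; ring
    simp only [eulerII, e1, e2, absPow_neg, absPow_mul, absPow_div, absPow_inv,
      absPow_eq_exp t0.ne', absPow_eq_exp (pos t t1).ne',
      absPow_eq_exp (pos_one_sub_mul hx1 t0 t1).ne', ← Complex.exp_add, one_mul]
    congr 1
    ring
  · have hx1 : 1 - x < 1 := by grind
    have hx2 : x ≠ 1 := by grind
    have hx3 : 1 - x ≠ 0 := sub_ne_zero.2 hx2.symm
    refine hasEulerRep_of_substitution_one_sub (A := c - a) (B := c - b) (C := c - a - b + 1)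
      (D := 1 - a) (K := absPow (1 - x) (c - a - b)) hx2 hx1 h1 (by simpa using h2)
      (by ring) (by rw [w₆, Complex.ofReal_sub, Complex.ofReal_one])
      (by rw [mul_comm (Complex.Gamma (c - b))]) fun t t0 t1 => ?_
    have e1 : 1 - (1 - (1 - x) * t) = (1 - x) * t := by ring
    have e2 : x - (1 - (1 - x) * t) = -((1 - x) * (1 - t)) := by ring
    simp only [eulerII, e1, e2, absPow_neg, absPow_mul,
      absPow_eq_exp hx3, absPow_eq_exp t0.ne', absPow_eq_exp (pos t t1).ne',
      absPow_eq_exp (pos_one_sub_mul hx1 t0 t1).ne', ← Complex.exp_add]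
    congr 1
    ring
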